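/- \textbf{Setting.} Let $M\ge 1$ and $\mathcal U=\{1,\dots,M\}$ (components). The hypotheses are $\mathcal X=\{0,1,\dots,M\}$, where $X=0$ means that no component is anomalous and $X=j\ge 1$ means that exactly component $j$ is anomalous. $X$ has a prior $\rho_1$ with $\rho_1(x)>0$ for all $x\in\mathcal X$. Let $\mathcal Y$ be a measurable space with a $\sigma$-finite measure $\nu$, and for each $u\in\mathcal U$ let $p_0^u,p_1^u$ be probability densities with respect to $\nu$. For each $N$, the agent performs $N$ experiments: at time $n\le N$ it draws a component $U_n$ from a distribution $g_n(U_{1:n-1},Y_{1:n-1})$ on $\mathcal U$ (which may depend measurably on the past) and then observes $Y_n$ with density $p_1^{U_n}$ if $X=U_n$ and $p_0^{U_n}$ if $X\ne U_n$. After $N$ experiments it draws a verdict $\hat X_N\in\{\text{safe},\text{unsafe}\}$ from a distribution $f(U_{1:N},Y_{1:N})$ (again measurable in the data). The distributions $p_0^u,p_1^u$ may depend on $u$ (a heterogeneous system). For $0<\epsilon_N<1$ let $$\phi_N^*=\inf_{f,g}\ \mathbb P^{f,g}[\hat X_N=\text{safe}\mid X\neq 0]\quad\text{subject to}\quad \mathbb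 P^{f,g}[\hat X_N=\text{safe}\mid X=0]\ge 1-\epsilon_N .$$ For $j,u\in\mathcal U$ let $\lambda_j(u,y)=\log\frac{p_0^u(y)}{p_1^u(y)}\in[-\infty,\infty]$ if $u=j$ and $\lambda_j(u,y)=0$ otherwise, let $D_j^u=\int \lambda_j(u,y)\,p_0^u(y)\,d\nu(y)$, and let $$D^*=\max_{\alpha\in\Delta\mathcal U}\ \min_{j\in\mathcal U}\ \sum_{u\in\mathcal U}\alpha(u)D_j^u$$ be the max-min Kullback--Leibler divergence, where $\Delta\mathcal U$ is the set of probability distributions on $\mathcal U$. Assume $D_u^u>0$ for every $u\in\mathcal U$. \textbf{Theorem.} Assume that $0<\epsilon_N<1$ for all $N$, that $\epsilon_N\to 0$ and $\frac{-\log\epsilon_N}{N}\to 0$ as $N\to\infty$, and that there is a constant $B>0$ such that for all $j,u\in\mathcal U$ and $k\in\{0,1\}$ one has $|\lambda_j(u,Y)|<B$ almost surely when $Y$ has density $p_k^u$. Then $\phi_N^*>0$ for every $N$, and $$\lim_{N\to\infty}-\frac1N\log\phi_N^*=D^*.$$ -/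

import Mathlib

open MeasureTheory ProbabilityTheory Filter Topology
open scoped ENNReal NNReal

namespace AnomalyVerification

/-- The statistical model of a (possibly heterogeneous) system with components `Fin M` and
observation space `Y`.  `p 0 u` and `p 1 u` are the densities, with respect to the `σ`-finite
measure `ν`, of an observation obtained by probing component `u` when `u` is normal,
respectively anomalous. -/
structure ObservationModel (M : ℕ) (Y : Type*) [MeasurableSpace Y] where
  ν : Measure Y
  sigmaFinite : SigmaFinite ν
  p : Fin 2 → Fin M → Y → ℝ≥0
  measurable_p : ∀ k u, Measurable (p k u)
  lintegral_p : ∀ k u, ∫⁻ y, (p k u y : ℝ≥0∞) ∂ν = 1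

/-- The past `n` experiments: the selected components and the observations obtained. -/
abbrev History (M : ℕ) (Y : Type*) (n : ℕ) : Type _ := Fin n → Fin M × Y

/-- The final declaration of the agent. -/
inductive Verdict
  | safe
  | anomaly

instance : MeasurableSpace Verdict := ⊤

/-- A randomized adaptive experiment selection strategy for `N` experiments: `rule n` maps the
first `n` experiments to the distribution from which the next component is drawn. -/
structure SelectionStrategy (M : ℕ) (Y : Type*) [MeasurableSpace Y] (N : ℕ) where
  rule : (n : Fin N) → Kernel (History M Y n) (Fin M)
  markov : ∀ n, IsMarkovKernel (rule n)

/-- A randomized inference strategy after `N` experiments. -/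
structure InferenceStrategy (M : ℕ) (Y : Type*) [MeasurableSpace Y] (N : ℕ) where
  rule : Kernel (History M Y N) Verdict
  markov : IsMarkovKernel rule

namespace ObservationModel

variable {M : ℕ} {Y : Type*} [MeasurableSpace Y]

/-- The law with density `p k u` of an observation of component `u`. -/
noncomputable def obsLaw (S : ObservationModel M Y) (k : Fin 2) (u : Fin M) : Measure Y :=
  S.ν.withDensity (fun y => (S.p k u y : ℝ≥0∞))

/-- The law of an observation given the probed component, under hypothesis `x`.  Hypothesis `0`
says that there is no anomaly, hypothesis `j.succ` that component `j` is anomalous. -/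
noncomputable def obsKernel (S : ObservationModel M Y) (x : Fin (M + 1)) : Kernel (Fin M) Y :=
  Kernel.ofFunOfCountable (fun u => S.obsLaw (if x = u.succ then 1 else 0) u)

/-- The law of the first `n` experiments under hypothesis `x` and strategy `g`: given the past,
the next component is drawn from the selection rule, and then its observation is drawn. -/
noncomputable def historyLaw (S : ObservationModel M Y) {N : ℕ} (g : SelectionStrategy M Y N)
    (x : Fin (M + 1)) : (n : ℕ) → n ≤ N → Measure (History M Y n)
  | 0, _ => Measure.dirac (fun i => i.elim0)
  | n + 1, h =>
      ((S.historyLaw g x n (Nat.le_of_succ_le h)) ⊗ₘ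
        ((g.rule ⟨n, h⟩) ⊗ₖ (Kernel.prodMkLeft (History M Y n) (S.obsKernel x)))).map
        (fun q => (Fin.snoc (α := fun _ => Fin M × Y) q.1 q.2 : History M Y (n + 1)))

/-- The joint law of the hypothesis (with prior `ρ`), the `N` experiments and the verdict. -/
noncomputable def jointLaw (S : ObservationModel M Y) (ρ : PMF (Fin (M + 1))) {N : ℕ}
    (f : InferenceStrategy M Y N) (g : SelectionStrategy M Y N) :
    Measure (Fin (M + 1) × (History M Y N × Verdict)) :=
  ρ.toMeasure ⊗ₘ Kernel.ofFunOfCountable (fun x => S.historyLaw g x N le_rfl ⊗ₘ f.rule)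

/-- The correct-verification probability `ℙ[verdict safe | no anomaly]`. -/
noncomputable def correctProb (S : ObservationModel M Y) (ρ : PMF (Fin (M + 1))) {N : ℕ}
    (f : InferenceStrategy M Y N) (g : SelectionStrategy M Y N) : ℝ :=
  (cond (S.jointLaw ρ f g) {ω | ω.1 = 0}).real {ω | ω.2.2 = Verdict.safe}

/-- The incorrect-verification probability `ℙ[verdict safe | some component is anomalous]`. -/
noncomputable def incorrectProb (S : ObservationModel M Y) (ρ : PMF (Fin (M + 1))) {N : ℕ}
    (f : InferenceStrategy M Y N) (g : SelectionStrategy M Y N) : ℝ :=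
  (cond (S.jointLaw ρ f g) {ω | ω.1 ≠ 0}).real {ω | ω.2.2 = Verdict.safe}

/-- The infimum of the incorrect-verification probability over all pairs of strategies with `N`
experiments whose correct-verification probability is at least `1 - ε`. -/
noncomputable def optimalIncorrectProb (S : ObservationModel M Y) (ρ : PMF (Fin (M + 1)))
    (N : ℕ) (ε : ℝ) : ℝ :=
  sInf {φ : ℝ | ∃ (f : InferenceStrategy M Y N) (g : SelectionStrategy M Y N),
    1 - ε ≤ S.correctProb ρ f g ∧ φ = S.incorrectProb ρ f g}

/-- The log-likelihood ratio of hypothesis `0` against the anomaly of `j`, for the observation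
`y` of component `u`.  It is extended-real valued: it is `⊤` where only `p 1 u` vanishes and `⊥`
where only `p 0 u` vanishes. -/
noncomputable def logLikelihoodRatio (S : ObservationModel M Y) (j u : Fin M) (y : Y) : EReal :=
  if u = j then ENNReal.log ((S.p 0 u y : ℝ≥0∞) / (S.p 1 u y : ℝ≥0∞)) else 0

/-- The expectation of the log-likelihood ratio when the observed component is normal. -/
noncomputable def divergence (S : ObservationModel M Y) (j u : Fin M) : ℝ :=
  ∫ y, (S.logLikelihoodRatio j u y).toReal ∂(S.obsLaw 0 u)

/-- The max-min Kullback-Leibler divergence: the maximum, over distributions `α` on the set of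
components, of `min_j ∑ u, α u * D_j^u`. -/
noncomputable def maxMinDivergence (S : ObservationModel M Y) : ℝ :=
  ⨆ α : stdSimplex ℝ (Fin M), ⨅ j : Fin M, ∑ u : Fin M, (α : Fin M → ℝ) u * S.divergence j u

end ObservationModel

end AnomalyVerification

/-! Write `D j` for `S.divergence j j`. Probing `u ≠ j` says nothing about an anomaly at `j`, so the
game matrix is diagonal. Its value is `D* = (∑ j, (D j)⁻¹)⁻¹`, attained by the distribution
proportional to `(D j)⁻¹`.

Converse: under hypothesis `0`, the log-likelihood ratio against `j` summed over the history has
mean `D j` times the expected number of probes of `j`, even for adaptive selection (a Wald identity,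
`integral_pathSum_eq_zero`). The probe counts add up to `N`, so for some `j` this mean is at most `N
* D*` (`exists_integral_truncLLR_le`). Changing measure from `j` to `0`
(`lintegral_historyLaw_change`), with a tangent-line form of Jensen's inequality
(`mul_exp_neg_le_integral_mul_exp_neg`), forces a miss probability of order `exp (-N * D*)` for that
`j`. Since the prior is positive, averaging over anomalies costs only a constant factor.

Achievability: probe independently from the optimal distribution and declare safe when every summed
log-likelihood ratio is at least `N * b`, for a fixed `b < D*`. The change of measure bounds each
miss by `exp (-N * b)`. A Chernoff bound makes false alarms exponentially rare, hence eventually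
below `ε N`, which decays subexponentially. -/

namespace AnomalyVerification

namespace ObservationModel

variable {M : ℕ} {Y : Type*} [MeasurableSpace Y]

/-! ### History laws and their one-step recursion -/

instance isProbabilityMeasure_obsLaw (S : ObservationModel M Y) (k : Fin 2) (u : Fin M) :
    IsProbabilityMeasure (S.obsLaw k u) :=
  ⟨by simpa [obsLaw, withDensity_apply _ MeasurableSet.univ] using S.lintegral_p k u⟩

lemma obsKernel_apply (S : ObservationModel M Y) (x : Fin (M + 1)) (u : Fin M) :
    S.obsKernel x u = S.obsLaw (if x = u.succ then 1 else 0) u := rfl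

instance isMarkovKernel_obsKernel (S : ObservationModel M Y) (x : Fin (M + 1)) :
    IsMarkovKernel (S.obsKernel x) :=
  ⟨fun u => by rw [obsKernel_apply]; infer_instance⟩

lemma measurable_snoc (n : ℕ) :
    Measurable (fun q : History M Y n × (Fin M × Y) =>
      (Fin.snoc (α := fun _ => Fin M × Y) q.1 q.2 : History M Y (n + 1))) := by
  refine measurable_pi_iff.2 fun i => ?_
  refine Fin.lastCases ?_ (fun i => ?_) i
  · simpa using measurable_snd
  · simp only [Fin.snoc_castSucc]
    exact (measurable_pi_apply i).comp measurable_fst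

instance isProbabilityMeasure_historyLaw (S : ObservationModel M Y) {N : ℕ}
    (g : SelectionStrategy M Y N) (x : Fin (M + 1)) (n : ℕ) (h : n ≤ N) :
    IsProbabilityMeasure (S.historyLaw g x n h) := by
  induction n with
  | zero => unfold historyLaw; infer_instance
  | succ n ih =>
    have := ih (Nat.le_of_succ_le h)
    have := g.markov ⟨n, h⟩
    unfold historyLaw
    exact Measure.isProbabilityMeasure_map (measurable_snoc n).aemeasurable

lemma lintegral_historyLaw_succ (S : ObservationModel M Y) {N : ℕ}
    (g : SelectionStrategy M Y N) (x : Fin (M + 1)) (n : ℕ) (h : n + 1 ≤ N)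
    {F : History M Y (n + 1) → ℝ≥0∞} (hF : Measurable F) :
    ∫⁻ a, F a ∂(S.historyLaw g x (n + 1) h) =
      ∫⁻ a, ∫⁻ u, ∫⁻ y, F (Fin.snoc (α := fun _ => Fin M × Y) a (u, y))
        ∂(S.obsKernel x u) ∂(g.rule ⟨n, h⟩ a) ∂(S.historyLaw g x n (Nat.le_of_succ_le h)) := by
  have := g.markov ⟨n, h⟩
  have hm : Measurable (fun q : History M Y n × (Fin M × Y) =>
      F (Fin.snoc (α := fun _ => Fin M × Y) q.1 q.2)) := hF.comp (measurable_snoc n)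
  rw [historyLaw, lintegral_map hF (measurable_snoc n), Measure.lintegral_compProd hm]
  refine lintegral_congr fun a => ?_
  exact Kernel.lintegral_compProd _ _ _ (hm.comp measurable_prodMk_left)

lemma integral_historyLaw_succ (S : ObservationModel M Y) {N : ℕ}
    (g : SelectionStrategy M Y N) (x : Fin (M + 1)) (n : ℕ) (h : n + 1 ≤ N)
    {F : History M Y (n + 1) → ℝ} (hF : Measurable F) {C : ℝ} (hC : ∀ a, |F a| ≤ C) :
    ∫ a, F a ∂(S.historyLaw g x (n + 1) h) =
      ∫ a, ∫ u, ∫ y, F (Fin.snoc (α := fun _ => Fin M × Y) a (u, y))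
        ∂(S.obsKernel x u) ∂(g.rule ⟨n, h⟩ a) ∂(S.historyLaw g x n (Nat.le_of_succ_le h)) := by
  have := g.markov ⟨n, h⟩
  have hm : Measurable (fun q : History M Y n × (Fin M × Y) =>
      F (Fin.snoc (α := fun _ => Fin M × Y) q.1 q.2)) := hF.comp (measurable_snoc n)
  rw [historyLaw, integral_map (measurable_snoc n).aemeasurable hF.aestronglyMeasurable,
    Measure.integral_compProd
      (Integrable.of_bound hm.aestronglyMeasurable C (ae_of_all _ fun _ => hC _))]
  refine integral_congr_ae (ae_of_all _ fun a => ?_)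
  have hm' : Measurable (fun b : Fin M × Y => F (Fin.snoc (α := fun _ => Fin M × Y) a b)) :=
    hm.comp measurable_prodMk_left
  exact ProbabilityTheory.integral_compProd
    (Integrable.of_bound hm'.aestronglyMeasurable C (ae_of_all _ fun _ => hC _))

/-! ### Additive functionals: change of measure, centring, exponential moments -/

/-- The additive functional of the history with one-step contribution `c`. -/
def pathSum (c : Fin M × Y → ℝ) {n : ℕ} (a : History M Y n) : ℝ := ∑ i, c (a i)

omit [MeasurableSpace Y] in
lemma pathSum_snoc (c : Fin M × Y → ℝ) {n : ℕ} (a : History M Y n) (b : Fin M × Y) :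
    pathSum c (Fin.snoc (α := fun _ => Fin M × Y) a b : History M Y (n + 1)) =
      pathSum c a + c b := by
  simp [pathSum, Fin.sum_univ_castSucc]

lemma measurable_pathSum {c : Fin M × Y → ℝ} (hc : Measurable c) (n : ℕ) :
    Measurable (pathSum c : History M Y n → ℝ) := by
  unfold pathSum
  fun_prop

omit [MeasurableSpace Y] in
lemma abs_pathSum_le {c : Fin M × Y → ℝ} {B : ℝ} (hB : ∀ b, |c b| ≤ B) {n : ℕ}
    (a : History M Y n) : |pathSum c a| ≤ n * B := by
  refine (Finset.abs_sum_le_sum_abs _ _).trans ?_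
  simpa using Finset.sum_le_sum (fun i (_ : i ∈ Finset.univ) => hB (a i))

/-- If hypothesis `x` has one-step likelihood ratio `exp (-c)` with respect to hypothesis `0`,
then its history law has likelihood ratio `exp (-pathSum c)`. -/
lemma lintegral_historyLaw_change (S : ObservationModel M Y) {N : ℕ}
    (g : SelectionStrategy M Y N) (x : Fin (M + 1)) {c : Fin M × Y → ℝ} (hc : Measurable c)
    (hx : ∀ u, S.obsKernel x u =
      (S.obsKernel 0 u).withDensity fun y => ENNReal.ofReal (Real.exp (-c (u, y))))
    (n : ℕ) (h : n ≤ N) {F : History M Y n → ℝ≥0∞} (hF : Measurable F) :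
    ∫⁻ a, F a ∂(S.historyLaw g x n h) =
      ∫⁻ a, F a * ENNReal.ofReal (Real.exp (-pathSum c a)) ∂(S.historyLaw g 0 n h) := by
  induction n with
  | zero => simp [historyLaw, pathSum]
  | succ n ih =>
    have hE : ∀ m, Measurable (fun a : History M Y m =>
        ENNReal.ofReal (Real.exp (-pathSum c a))) := fun m => by
      have := measurable_pathSum hc m
      fun_prop
    have := g.markov ⟨n, h⟩
    have hs := measurable_snoc (M := M) (Y := Y) n
    rw [lintegral_historyLaw_succ S g x n h hF,
      lintegral_historyLaw_succ S g 0 n h (F := fun a => F a * ENNReal.ofReal (Real.exp (-pathSum c a)))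
        (hF.mul (hE _)), ih]
    · refine lintegral_congr fun a => ?_
      rw [← lintegral_mul_const _ (measurable_of_countable _)]
      refine lintegral_congr fun u => ?_
      have hFa : Measurable (fun y => F (Fin.snoc (α := fun _ => Fin M × Y) a (u, y))) :=
        hF.comp (hs.comp (measurable_const.prodMk measurable_prodMk_left))
      have hcu : Measurable (fun y => ENNReal.ofReal (Real.exp (-c (u, y)))) := by fun_prop
      rw [hx u, lintegral_withDensity_eq_lintegral_mul _ hcu hFa,
        ← lintegral_mul_const _ (hcu.mul hFa)]
      refine lintegral_congr fun y => ?_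
      simp only [Pi.mul_apply]
      rw [pathSum_snoc, neg_add, Real.exp_add, ENNReal.ofReal_mul (Real.exp_nonneg _)]
      ring
    -- The induction hypothesis was applied to `F` with its last experiment integrated out under
    -- `x`; this function of the shorter history must be measurable.
    · have h1 : Measurable (fun q : (History M Y n × Fin M) × Y =>
          F (Fin.snoc (α := fun _ => Fin M × Y) q.1.1 (q.1.2, q.2))) :=
        hF.comp (hs.comp (measurable_fst.fst.prodMk (measurable_fst.snd.prodMk measurable_snd)))
      have h2 := Measurable.lintegral_kernel_prod_right'
        (κ := Kernel.prodMkLeft (History M Y n) (S.obsKernel x)) h1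
      exact Measurable.lintegral_kernel_prod_right' (κ := g.rule ⟨n, h⟩) h2

/-- A martingale identity: if the one-step contribution is centred under hypothesis `0`, then so
is its sum over the history. -/
lemma integral_pathSum_eq_zero (S : ObservationModel M Y) {N : ℕ}
    (g : SelectionStrategy M Y N) {c : Fin M × Y → ℝ} (hc : Measurable c) {B : ℝ}
    (hB : ∀ b, |c b| ≤ B) (h0 : ∀ u, ∫ y, c (u, y) ∂(S.obsKernel 0 u) = 0)
    (n : ℕ) (h : n ≤ N) : ∫ a, pathSum c a ∂(S.historyLaw g 0 n h) = 0 := by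
  induction n with
  | zero => simp [pathSum]
  | succ n ih =>
    rw [integral_historyLaw_succ S g 0 n h (measurable_pathSum hc _)
      (fun a => abs_pathSum_le hB a), ← ih (Nat.le_of_succ_le h)]
    refine integral_congr_ae (ae_of_all _ fun a => ?_)
    have := g.markov ⟨n, h⟩
    have : ∀ u, ∫ y, pathSum c (Fin.snoc (α := fun _ => Fin M × Y) a (u, y) :
        History M Y (n + 1)) ∂(S.obsKernel 0 u) = pathSum c a := fun u => by
      simp only [pathSum_snoc]
      have hi : Integrable (fun y => c (u, y)) (S.obsKernel 0 u) :=
        Integrable.of_bound (hc.comp measurable_prodMk_left).aestronglyMeasurable B (ae_of_all _ fun _ => hB _)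
      rw [integral_add (integrable_const _) hi, h0 u]
      simp
    simp [this]

/-- If every one-step exponential moment is at most `r`, then the one of the sum over `n` steps
is at most `r ^ n`. -/
lemma lintegral_exp_pathSum_le (S : ObservationModel M Y) {N : ℕ}
    (g : SelectionStrategy M Y N) (x : Fin (M + 1)) {c : Fin M × Y → ℝ} (hc : Measurable c)
    {r : ℝ≥0∞} (hr : ∀ n a, ∫⁻ u, ∫⁻ y, ENNReal.ofReal (Real.exp (c (u, y)))
      ∂(S.obsKernel x u) ∂(g.rule n a) ≤ r)
    (n : ℕ) (h : n ≤ N) :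
    ∫⁻ a, ENNReal.ofReal (Real.exp (pathSum c a)) ∂(S.historyLaw g x n h) ≤ r ^ n := by
  induction n with
  | zero => simp [historyLaw, pathSum]
  | succ n ih =>
    have hE : ∀ m, Measurable (fun a : History M Y m =>
        ENNReal.ofReal (Real.exp (pathSum c a))) := fun m => by
      have := measurable_pathSum hc m
      fun_prop
    rw [lintegral_historyLaw_succ S g x n h (hE _), pow_succ]
    refine le_trans ?_ (mul_le_mul_left (ih (Nat.le_of_succ_le h)) r)
    rw [← lintegral_mul_const _ (hE n)]
    refine lintegral_mono fun a => ?_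
    refine le_trans (le_of_eq ?_) (mul_le_mul_right (hr ⟨n, h⟩ a) _)
    rw [← lintegral_const_mul _ (measurable_of_countable _)]
    refine lintegral_congr fun u => ?_
    rw [← lintegral_const_mul _ (by fun_prop)]
    refine lintegral_congr fun y => ?_
    rw [pathSum_snoc, Real.exp_add, ENNReal.ofReal_mul (Real.exp_nonneg _)]

/-! ### The truncated log-likelihood ratio as a one-step density -/

lemma measurable_logLikelihoodRatio (S : ObservationModel M Y) (j u : Fin M) :
    Measurable (S.logLikelihoodRatio j u) := by
  unfold logLikelihoodRatio
  split_ifs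
  · exact ENNReal.log_monotone.measurable.comp
      ((S.measurable_p 0 u).coe_nnreal_ennreal.div (S.measurable_p 1 u).coe_nnreal_ennreal)
  · exact measurable_const

/-- The real-valued log-likelihood ratio, truncated to `[-B, B]`. -/
noncomputable def truncLLR (S : ObservationModel M Y) (B : ℝ) (j : Fin M) (b : Fin M × Y) : ℝ :=
  max (-B) (min B (S.logLikelihoodRatio j b.1 b.2).toReal)

lemma measurable_truncLLR (S : ObservationModel M Y) (B : ℝ) (j : Fin M) :
    Measurable (S.truncLLR B j) := by
  refine measurable_from_prod_countable_right fun u => ?_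
  have := (S.measurable_logLikelihoodRatio j u).ereal_toReal
  unfold truncLLR
  fun_prop

lemma abs_truncLLR_le (S : ObservationModel M Y) {B : ℝ} (hB : 0 ≤ B) (j : Fin M)
    (b : Fin M × Y) : |S.truncLLR B j b| ≤ B :=
  abs_le.2 ⟨le_max_left _ _, max_le (by linarith) (min_le_left _ _)⟩

lemma truncLLR_of_ne (S : ObservationModel M Y) {B : ℝ} (hB : 0 ≤ B) {j u : Fin M} (h : u ≠ j)
    (y : Y) : S.truncLLR B j (u, y) = 0 := by
  simp [truncLLR, logLikelihoodRatio, h, hB]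

lemma coe_truncLLR (S : ObservationModel M Y) {B : ℝ} {j u : Fin M} {y : Y}
    (h : (S.logLikelihoodRatio j u y).abs < ENNReal.ofReal B) :
    (S.truncLLR B j (u, y) : EReal) = S.logLikelihoodRatio j u y := by
  unfold truncLLR
  dsimp only
  induction hx : S.logLikelihoodRatio j u y with
  | bot => simp [hx] at h
  | top => simp [hx] at h
  | coe r =>
    rw [hx, EReal.abs_def, ENNReal.ofReal_lt_ofReal_iff'] at h
    have := abs_lt.1 h.1
    rw [EReal.toReal_coe, min_eq_right this.2.le, max_eq_right this.1.le]

lemma divergence_eq_integral_truncLLR (S : ObservationModel M Y) {B : ℝ} {j u : Fin M}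
    (h : ∀ᵐ y ∂(S.obsLaw 0 u), (S.logLikelihoodRatio j u y).abs < ENNReal.ofReal B) :
    S.divergence j u = ∫ y, S.truncLLR B j (u, y) ∂(S.obsLaw 0 u) := by
  refine integral_congr_ae ?_
  filter_upwards [h] with y hy
  simp [← S.coe_truncLLR hy]

lemma divergence_of_ne (S : ObservationModel M Y) {j u : Fin M} (h : u ≠ j) :
    S.divergence j u = 0 := by
  simp [divergence, logLikelihoodRatio, h]

lemma obsKernel_zero (S : ObservationModel M Y) (u : Fin M) :
    S.obsKernel 0 u = S.obsLaw 0 u := by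
  rw [obsKernel_apply, if_neg (Fin.succ_ne_zero u).symm]

/-- The bound on the ratio holds under both densities, so `ν`-almost everywhere they vanish together
or are both positive. Hence the two laws are mutually absolutely continuous, truncation changes
nothing, and `p 1 = p 0 * exp (-log (p 0 / p 1))`. -/
lemma obsKernel_succ_eq_withDensity (S : ObservationModel M Y) {B : ℝ} (hB : 0 ≤ B)
    (h : ∀ (j u : Fin M) (k : Fin 2),
      ∀ᵐ y ∂(S.obsLaw k u), (S.logLikelihoodRatio j u y).abs < ENNReal.ofReal B)
    (j u : Fin M) :
    S.obsKernel j.succ u = (S.obsKernel 0 u).withDensity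
      fun y => ENNReal.ofReal (Real.exp (-S.truncLLR B j (u, y))) := by
  rw [obsKernel_zero, obsKernel_apply]
  by_cases hu : u = j
  · subst hu
    rw [if_pos rfl]
    have hc := S.measurable_truncLLR B u
    have hp := fun k => (S.measurable_p k u).coe_nnreal_ennreal
    have h' : ∀ k, ∀ᵐ y ∂S.ν, (S.p k u y : ℝ≥0∞) ≠ 0 →
        (S.logLikelihoodRatio u u y).abs < ENNReal.ofReal B := fun k =>
      (ae_withDensity_iff (hp k)).1 (h u u k)
    unfold obsLaw
    rw [← withDensity_mul _ (hp 0) (by fun_prop)]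
    refine withDensity_congr_ae ?_
    filter_upwards [h' 0, h' 1] with y h0 h1
    simp only [Pi.mul_apply]
    by_cases hz : S.p 0 u y = 0 ∧ S.p 1 u y = 0
    · simp [hz]
    · have hb : (S.logLikelihoodRatio u u y).abs < ENNReal.ofReal B := by
        by_cases h00 : S.p 0 u y = 0
        · exact h1 (by simpa using fun h11 => hz ⟨h00, h11⟩)
        · exact h0 (by simpa using h00)
      have hcoe := S.coe_truncLLR hb
      have hl : S.logLikelihoodRatio u u y =
        ENNReal.log ((S.p 0 u y : ℝ≥0∞) / (S.p 1 u y : ℝ≥0∞)) := if_pos rfl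
      have h00 : S.p 0 u y ≠ 0 := by
        intro h00
        simp [hl, h00] at hb
      have h11 : S.p 1 u y ≠ 0 := by
        intro h11
        simp [hl, h11, ENNReal.div_zero, h00] at hb
      have h0pos : (0 : ℝ) < S.p 0 u y := by positivity
      have h1pos : (0 : ℝ) < S.p 1 u y := by positivity
      have hval : S.truncLLR B u (u, y) = Real.log (S.p 0 u y / S.p 1 u y) := by
        rw [hl, ← ENNReal.coe_div h11, ENNReal.log_of_nnreal (by positivity)] at hcoe
        exact_mod_cast hcoe
      rw [hval, Real.exp_neg, Real.exp_log (by positivity), inv_div,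
        ← ENNReal.ofReal_coe_nnreal, ← ENNReal.ofReal_coe_nnreal (p := S.p 0 u y),
        ← ENNReal.ofReal_mul h0pos.le]
      congr 1
      field_simp
  · rw [if_neg (by simpa using Ne.symm hu)]
    simp [S.truncLLR_of_ne hB hu]

/-! ### Verdict probabilities in terms of the history laws -/

/-- The probability, under hypothesis `x`, that the verdict is safe. -/
noncomputable def safeProb (S : ObservationModel M Y) {N : ℕ}
    (f : InferenceStrategy M Y N) (g : SelectionStrategy M Y N) (x : Fin (M + 1)) : ℝ≥0∞ :=
  ∫⁻ a, f.rule a {Verdict.safe} ∂(S.historyLaw g x N le_rfl)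

lemma safeProb_le_one (S : ObservationModel M Y) {N : ℕ}
    (f : InferenceStrategy M Y N) (g : SelectionStrategy M Y N) (x : Fin (M + 1)) :
    S.safeProb f g x ≤ 1 := by
  have := f.markov
  calc S.safeProb f g x ≤ ∫⁻ _, 1 ∂(S.historyLaw g x N le_rfl) :=
        lintegral_mono fun a => prob_le_one
    _ = 1 := by simp

lemma safeProb_ne_top (S : ObservationModel M Y) {N : ℕ}
    (f : InferenceStrategy M Y N) (g : SelectionStrategy M Y N) (x : Fin (M + 1)) :
    S.safeProb f g x ≠ ∞ := ((S.safeProb_le_one f g x).trans_lt ENNReal.one_lt_top).ne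

lemma jointLaw_apply_prod (S : ObservationModel M Y) (ρ : PMF (Fin (M + 1))) {N : ℕ}
    (f : InferenceStrategy M Y N) (g : SelectionStrategy M Y N) (s : Set (Fin (M + 1)))
    {t : Set (History M Y N × Verdict)} (ht : MeasurableSet t) :
    S.jointLaw ρ f g (s ×ˢ t) =
      ∑ x, (S.historyLaw g x N le_rfl ⊗ₘ f.rule) t * s.indicator ρ x := by
  have := f.markov
  have : IsMarkovKernel (Kernel.ofFunOfCountable
      (fun x => S.historyLaw g x N le_rfl ⊗ₘ f.rule)) :=
    ⟨fun x => by
      change IsProbabilityMeasure (S.historyLaw g x N le_rfl ⊗ₘ f.rule)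
      infer_instance⟩
  rw [jointLaw, Measure.compProd_apply_prod s.toFinite.measurableSet ht,
    ← lintegral_indicator s.toFinite.measurableSet, lintegral_fintype]
  refine Finset.sum_congr rfl fun x _ => ?_
  rw [PMF.toMeasure_apply_singleton _ _ (measurableSet_singleton x)]
  by_cases hx : x ∈ s
  · simp only [Set.indicator_of_mem hx]; rfl
  · simp [hx]

lemma compProd_safe (S : ObservationModel M Y) {N : ℕ}
    (f : InferenceStrategy M Y N) (g : SelectionStrategy M Y N) (x : Fin (M + 1)) :
    (S.historyLaw g x N le_rfl ⊗ₘ f.rule) (Set.univ ×ˢ {Verdict.safe}) = S.safeProb f g x := by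
  have := f.markov
  rw [Measure.compProd_apply_prod MeasurableSet.univ (by trivial : MeasurableSet {Verdict.safe}), Measure.restrict_univ, safeProb]

lemma cond_jointLaw_safe (S : ObservationModel M Y) (ρ : PMF (Fin (M + 1))) {N : ℕ}
    (f : InferenceStrategy M Y N) (g : SelectionStrategy M Y N) (s : Set (Fin (M + 1))) :
    cond (S.jointLaw ρ f g) {ω | ω.1 ∈ s} {ω | ω.2.2 = Verdict.safe} =
      (∑ x, s.indicator ρ x)⁻¹ * ∑ x, S.safeProb f g x * s.indicator ρ x := by
  have := f.markov
  have h1 : {ω : Fin (M + 1) × (History M Y N × Verdict) | ω.1 ∈ s} = s ×ˢ Set.univ := by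
    ext; simp
  have h2 : (s ×ˢ Set.univ) ∩ {ω : Fin (M + 1) × (History M Y N × Verdict) |
      ω.2.2 = Verdict.safe} = s ×ˢ (Set.univ ×ˢ {Verdict.safe}) := by
    ext; simp
  have hm : MeasurableSet ((Set.univ : Set (History M Y N)) ×ˢ {Verdict.safe}) :=
    MeasurableSet.univ.prod trivial
  rw [h1, cond_apply (s.toFinite.measurableSet.prod MeasurableSet.univ), h2,
    S.jointLaw_apply_prod ρ f g s MeasurableSet.univ, S.jointLaw_apply_prod ρ f g s hm]
  simp [S.compProd_safe]

lemma correctProb_eq (S : ObservationModel M Y) {ρ : PMF (Fin (M + 1))} (hρ : ∀ x, 0 < ρ x)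
    {N : ℕ} (f : InferenceStrategy M Y N) (g : SelectionStrategy M Y N) :
    S.correctProb ρ f g = (S.safeProb f g 0).toReal := by
  have h := S.cond_jointLaw_safe ρ f g {0}
  have hs : ∀ c : Fin (M + 1) → ℝ≥0∞,
      ∑ x, c x * ({0} : Set (Fin (M + 1))).indicator ρ x = c 0 * ρ 0 := fun c => by
    simp [Set.indicator_apply]
  have h1 := hs 1
  simp only [Pi.one_apply, one_mul] at h1
  rw [hs, h1, mul_comm (S.safeProb f g 0), ← mul_assoc,
    ENNReal.inv_mul_cancel (hρ 0).ne' (ρ.apply_ne_top 0), one_mul] at h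
  rw [correctProb, Measure.real, ← h]
  rfl

lemma incorrectProb_eq (S : ObservationModel M Y) {ρ : PMF (Fin (M + 1))}
    {N : ℕ} (f : InferenceStrategy M Y N) (g : SelectionStrategy M Y N) :
    S.incorrectProb ρ f g = (∑ j : Fin M, (S.safeProb f g j.succ).toReal * (ρ j.succ).toReal) /
      ∑ j : Fin M, (ρ j.succ).toReal := by
  have h := S.cond_jointLaw_safe ρ f g {0}ᶜ
  have hs : ∀ c : Fin (M + 1) → ℝ≥0∞,
      ∑ x, c x * ({0}ᶜ : Set (Fin (M + 1))).indicator ρ x =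
        ∑ j : Fin M, c j.succ * ρ j.succ := fun c => by
    simp [Fin.sum_univ_succ]
  have h1 := hs 1
  simp only [Pi.one_apply, one_mul] at h1
  rw [hs, h1] at h
  have h2 : S.incorrectProb ρ f g = ((∑ j : Fin M, ρ j.succ)⁻¹ *
      ∑ j : Fin M, S.safeProb f g j.succ * ρ j.succ).toReal := by
    rw [incorrectProb, Measure.real, ← h]
    rfl
  rw [h2, ENNReal.toReal_mul, ENNReal.toReal_inv, ENNReal.toReal_sum fun j _ => ρ.apply_ne_top _,
    ENNReal.toReal_sum fun j _ => ENNReal.mul_ne_top (S.safeProb_ne_top f g _) (ρ.apply_ne_top _)]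
  simp only [ENNReal.toReal_mul]
  rw [div_eq_inv_mul]

/-! ### The value of the diagonal max-min game -/

lemma divergence_sum (S : ObservationModel M Y) (α : Fin M → ℝ) (j : Fin M) :
    ∑ u, α u * S.divergence j u = α j * S.divergence j j := by
  refine Finset.sum_eq_single j (fun u _ hu => ?_) (by simp)
  rw [S.divergence_of_ne hu, mul_zero]

/-- The weights `T⁻¹ * (D j)⁻¹` equalize all the payoffs `α j * D j`. If some `α` made every payoff
exceed `T⁻¹`, each of its weights would exceed these, and its total mass would exceed `1`. -/
lemma maxMinDivergence_eq (hM : 0 < M) (S : ObservationModel M Y)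
    (hD : ∀ u, 0 < S.divergence u u) :
    S.maxMinDivergence = (∑ u, (S.divergence u u)⁻¹)⁻¹ := by
  have : Nonempty (Fin M) := ⟨⟨0, hM⟩⟩
  set T := ∑ u, (S.divergence u u)⁻¹ with hT
  have hTpos : 0 < T := Finset.sum_pos (fun u _ => inv_pos.2 (hD u)) Finset.univ_nonempty
  unfold maxMinDivergence
  simp only [divergence_sum]
  have hle : ∀ α : stdSimplex ℝ (Fin M),
      ⨅ j, (α : Fin M → ℝ) j * S.divergence j j ≤ T⁻¹ := fun α => by
    by_contra! hlt
    have h1 : ∀ j, T⁻¹ * (S.divergence j j)⁻¹ < (α : Fin M → ℝ) j := fun j => by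
      have := hlt.trans_le (ciInf_le (Set.finite_range _).bddBelow j)
      rwa [← div_eq_mul_inv, div_lt_iff₀ (hD j)]
    have h2 := Finset.sum_lt_sum_of_nonempty Finset.univ_nonempty (fun j _ => h1 j)
    rw [← Finset.mul_sum, ← hT, inv_mul_cancel₀ hTpos.ne'] at h2
    exact h2.ne α.2.2.symm
  have hα : (fun u => T⁻¹ * (S.divergence u u)⁻¹) ∈ stdSimplex ℝ (Fin M) :=
    ⟨fun u => mul_nonneg (inv_pos.2 hTpos).le (inv_pos.2 (hD u)).le, by
      rw [← Finset.mul_sum, ← hT, inv_mul_cancel₀ hTpos.ne']⟩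
  have : Nonempty (stdSimplex ℝ (Fin M)) := ⟨⟨_, hα⟩⟩
  refine le_antisymm (ciSup_le hle) (le_ciSup_of_le ⟨_, Set.forall_mem_range.2 hle⟩ ⟨_, hα⟩ ?_)
  refine le_ciInf fun j => ?_
  exact (inv_mul_cancel_right₀ (hD j).ne' _).ge

end ObservationModel

/-! ### Two inequalities for bounded random variables -/

/-- A change-of-measure bound: a test `w` that accepts with probability at least `1 - ε` still
accepts with probability at least `(1 - ε) * exp (-m)` after tilting by `exp (-L)`. -/
lemma mul_exp_neg_le_integral_mul_exp_neg {Ω : Type*} [MeasurableSpace Ω] (μ : Measure Ω)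
    [IsProbabilityMeasure μ] {w L : Ω → ℝ} (hw : Measurable w) (hL : Measurable L)
    (hw0 : ∀ a, 0 ≤ w a) (hw1 : ∀ a, w a ≤ 1) {K A ε m : ℝ} (hK : ∀ a, |L a| ≤ K)
    (hint : 1 - ε ≤ ∫ a, w a ∂μ) (hA : ∫ a, L a ∂μ ≤ A) (hm0 : 0 ≤ m) (hK0 : 0 ≤ K)
    (hm : A + K * ε ≤ m * (1 - ε)) :
    (1 - ε) * Real.exp (-m) ≤ ∫ a, w a * Real.exp (-L a) ∂μ := by
  have hwabs : ∀ a, |w a| ≤ 1 := fun a => abs_le.2 ⟨by linarith [hw0 a], hw1 a⟩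
  have iw : Integrable w μ := Integrable.of_bound hw.aestronglyMeasurable 1 (ae_of_all _ hwabs)
  have iL : Integrable L μ := Integrable.of_bound hL.aestronglyMeasurable K (ae_of_all _ hK)
  have iwL : Integrable (fun a => w a * L a) μ :=
    iL.bdd_mul hw.aestronglyMeasurable (ae_of_all _ hwabs)
  have iE : Integrable (fun a => Real.exp (-L a)) μ := by
    refine Integrable.of_bound (by fun_prop) (Real.exp K) (ae_of_all _ fun a => ?_)
    rw [Real.norm_eq_abs, Real.abs_exp, Real.exp_le_exp]
    linarith [(abs_le.1 (hK a)).1]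
  have iwE : Integrable (fun a => w a * Real.exp (-L a)) μ :=
    iE.bdd_mul hw.aestronglyMeasurable (ae_of_all _ hwabs)
  have iKw : Integrable (fun a => K - K * w a) μ := (integrable_const K).sub (iw.const_mul K)
  -- Rests on `(L + K) * (1 - w) ≥ 0`: discarding the rejected part of `L` costs at most `K * (1 - ∫
  -- w) ≤ K * ε`.
  have h1 : ∫ a, w a * L a ∂μ ≤ m * ∫ a, w a ∂μ := by
    have : ∫ a, w a * L a ∂μ ≤ ∫ a, (L a + (K - K * w a)) ∂μ := by
      refine integral_mono iwL (iL.add iKw) fun a => ?_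
      have := (abs_le.1 (hK a)).1
      dsimp only
      nlinarith [hw1 a]
    rw [integral_add iL iKw, integral_sub (integrable_const K) (iw.const_mul K), integral_const_mul] at this
    simp only [integral_const, probReal_univ, one_smul] at this
    nlinarith
  -- The tangent line `exp (m - L) ≥ 1 + m - L` replaces Jensen's inequality. By `h1`, the left side
  -- is at least `exp (-m) * ∫ w`.
  have h2 : ∫ a, (Real.exp (-m) * ((1 + m) * w a - w a * L a)) ∂μ ≤
      ∫ a, w a * Real.exp (-L a) ∂μ := by
    refine integral_mono (((iw.const_mul _).sub iwL).const_mul _) iwE fun a => ?_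
    have h3 := Real.add_one_le_exp (m - L a)
    have h4 : Real.exp (-L a) = Real.exp (-m) * Real.exp (m - L a) := by
      rw [← Real.exp_add]; ring_nf
    dsimp only
    rw [h4]
    have := mul_le_mul_of_nonneg_left h3 (mul_nonneg (hw0 a) (Real.exp_nonneg (-m)))
    linarith
  rw [integral_const_mul, integral_sub (iw.const_mul _) iwL, integral_const_mul] at h2
  refine le_trans ?_ h2
  rw [mul_comm]
  exact mul_le_mul_of_nonneg_left (by linarith) (Real.exp_nonneg _)

/-- A bounded random variable with negative mean has an exponential moment below `1`. -/
lemma exists_lintegral_exp_mul_lt_one {Ω : Type*} [MeasurableSpace Ω] (μ : Measure Ω)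
    [IsProbabilityMeasure μ] {c : Ω → ℝ} (hc : Measurable c) {K : ℝ} (hK : ∀ a, |c a| ≤ K)
    (hneg : ∫ a, c a ∂μ < 0) :
    ∃ t r : ℝ, 0 < t ∧ 0 < r ∧ r < 1 ∧
      ∫⁻ a, ENNReal.ofReal (Real.exp (t * c a)) ∂μ ≤ ENNReal.ofReal r := by
  set d := -∫ a, c a ∂μ with hd
  have hd0 : 0 < d := by linarith
  have ic : Integrable c μ := Integrable.of_bound hc.aestronglyMeasurable K (ae_of_all _ hK)
  have hdK : d ≤ K := by
    have := norm_integral_le_of_norm_le_const (f := c) (ae_of_all μ hK)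
    rw [probReal_univ, mul_one, Real.norm_eq_abs] at this
    linarith [neg_le_abs (∫ a, c a ∂μ)]
  have hK0 : 0 < K := hd0.trans_le hdK
  -- Small enough that `|t * c| ≤ 1`, where `exp x ≤ 1 + x + x ^ 2`; the quadratic term is then at
  -- most `t * d / 2`, half of the first-order gain `t * d`.
  set t := d / (2 * K ^ 2) with ht
  have ht0 : 0 < t := by positivity
  have htK : t * K ≤ 1 := by
    rw [ht, div_mul_eq_mul_div, div_le_one (by positivity)]
    nlinarith
  have htd : t ^ 2 * K ^ 2 = t * d / 2 := by
    rw [ht]; field_simp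
  refine ⟨t, 1 - t * d / 2, ht0, ?_, by nlinarith [mul_pos ht0 hd0], ?_⟩
  · nlinarith
  have hpt : ∀ a, Real.exp (t * c a) ≤ 1 + t * c a + t * d / 2 := fun a => by
    have h1 : |t * c a| ≤ 1 := by
      rw [abs_mul, abs_of_pos ht0]
      exact (mul_le_mul_of_nonneg_left (hK a) ht0.le).trans htK
    have h2 := (abs_le.1 (Real.abs_exp_sub_one_sub_id_le h1)).2
    have h3 : (t * c a) ^ 2 ≤ t ^ 2 * K ^ 2 := by
      rw [mul_pow]
      exact mul_le_mul_of_nonneg_left (sq_le_sq' (abs_le.1 (hK a)).1 (abs_le.1 (hK a)).2)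
        (sq_nonneg t)
    linarith
  have hi' : Integrable (fun a => 1 + t * c a) μ := (integrable_const _).add (ic.const_mul t)
  have hi : Integrable (fun a => 1 + t * c a + t * d / 2) μ := hi'.add (integrable_const _)
  calc ∫⁻ a, ENNReal.ofReal (Real.exp (t * c a)) ∂μ
      ≤ ∫⁻ a, ENNReal.ofReal (1 + t * c a + t * d / 2) ∂μ :=
        lintegral_mono fun a => ENNReal.ofReal_le_ofReal (hpt a)
    _ = ENNReal.ofReal (∫ a, (1 + t * c a + t * d / 2) ∂μ) :=
        (ofReal_integral_eq_lintegral_ofReal hi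
          (ae_of_all _ fun a => (Real.exp_nonneg _).trans (hpt a))).symm
    _ = ENNReal.ofReal (1 - t * d / 2) := by
        rw [integral_add hi' (integrable_const _),
          integral_add (integrable_const _) (ic.const_mul t), integral_const_mul]
        simp only [integral_const, probReal_univ, one_smul]
        congr 1
        rw [hd]
        ring

namespace ObservationModel

variable {M : ℕ} {Y : Type*} [MeasurableSpace Y]

/-! ### Converse bound -/

/-- If every mean exceeded `N * D*`, the expected number of probes of each `j` would exceed `N * D*
/ D j`, and these bounds already sum to `N`. -/
lemma exists_integral_truncLLR_le (hM : 0 < M) (S : ObservationModel M Y)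
    (hD : ∀ u, 0 < S.divergence u u) {B : ℝ} (hB0 : 0 ≤ B)
    (hB : ∀ (j u : Fin M) (k : Fin 2),
      ∀ᵐ y ∂(S.obsLaw k u), (S.logLikelihoodRatio j u y).abs < ENNReal.ofReal B)
    {N : ℕ} (g : SelectionStrategy M Y N) :
    ∃ j, ∫ a, pathSum (S.truncLLR B j) a ∂(S.historyLaw g 0 N le_rfl) ≤
      N * S.maxMinDivergence := by
  have : Nonempty (Fin M) := ⟨⟨0, hM⟩⟩
  let e : Fin M → Fin M × Y → ℝ := fun j b => if b.1 = j then 1 else 0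
  have he : ∀ j, Measurable (e j) := fun j =>
    Measurable.ite (measurable_fst (measurableSet_singleton j)) measurable_const measurable_const
  have he1 : ∀ j b, |e j b| ≤ 1 := fun j b => by
    dsimp only [e]; split_ifs <;> simp
  have hint : ∀ {c : Fin M × Y → ℝ} {K : ℝ}, Measurable c → (∀ b, |c b| ≤ K) →
      Integrable (pathSum c : History M Y N → ℝ) (S.historyLaw g 0 N le_rfl) :=
    fun hc hK => Integrable.of_bound (measurable_pathSum hc N).aestronglyMeasurable _
      (ae_of_all _ (abs_pathSum_le hK))
  have hcount : ∑ j, ∫ a, pathSum (e j) a ∂(S.historyLaw g 0 N le_rfl) = N := by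
    rw [← integral_finsetSum _ fun j _ => hint (he j) (he1 j)]
    have : ∀ a : History M Y N, ∑ j, pathSum (e j) a = N := fun a => by
      simp only [pathSum]
      rw [Finset.sum_comm]
      simp [e]
    simp [this]
  have hmean : ∀ j, ∫ a, pathSum (S.truncLLR B j) a ∂(S.historyLaw g 0 N le_rfl) =
      S.divergence j j * ∫ a, pathSum (e j) a ∂(S.historyLaw g 0 N le_rfl) := fun j => by
    -- Subtracting `D j` at each probe of `j` centres the contribution for every component `u`, so
    -- the selection rule has no influence on the mean.
    have h0 := S.integral_pathSum_eq_zero g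
      (c := fun b => S.truncLLR B j b - S.divergence j j * e j b)
      ((S.measurable_truncLLR B j).sub ((he j).const_mul _)) (B := B + S.divergence j j)
      (fun b => (abs_sub _ _).trans (add_le_add (S.abs_truncLLR_le hB0 j b) (by
        rw [abs_mul, abs_of_pos (hD j)]
        exact mul_le_of_le_one_right (hD j).le (he1 j b))))
      (fun u => by
        have hi : Integrable (fun y => S.truncLLR B j (u, y)) (S.obsLaw 0 u) :=
          Integrable.of_bound
            ((S.measurable_truncLLR B j).comp measurable_prodMk_left).aestronglyMeasurable B
            (ae_of_all _ fun y => S.abs_truncLLR_le hB0 j _)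
        have hi' : Integrable (fun y => S.divergence j j * e j (u, y)) (S.obsLaw 0 u) :=
          integrable_const (S.divergence j j * if u = j then 1 else 0)
        rw [obsKernel_zero, integral_sub hi hi',
          ← S.divergence_eq_integral_truncLLR (hB j u 0)]
        by_cases hu : u = j
        · subst hu; simp [e]
        · simp [e, hu, S.divergence_of_ne hu])
      N le_rfl
    have h1 : ∀ a : History M Y N,
        pathSum (fun b => S.truncLLR B j b - S.divergence j j * e j b) a =
          pathSum (S.truncLLR B j) a - S.divergence j j * pathSum (e j) a := fun a => by
      simp [pathSum, Finset.mul_sum]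
    simp only [h1] at h0
    rw [integral_sub (hint (S.measurable_truncLLR B j) (S.abs_truncLLR_le hB0 j))
      ((hint (he j) (he1 j)).const_mul _), integral_const_mul] at h0
    linarith
  by_contra! hlt
  set T := ∑ u, (S.divergence u u)⁻¹ with hT
  have hTpos : 0 < T := Finset.sum_pos (fun u _ => inv_pos.2 (hD u)) Finset.univ_nonempty
  rw [S.maxMinDivergence_eq hM hD] at hlt
  have h1 : ∀ j, N * T⁻¹ * (S.divergence j j)⁻¹ <
      ∫ a, pathSum (e j) a ∂(S.historyLaw g 0 N le_rfl) := fun j => by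
    have := hlt j
    rwa [hmean, mul_comm (S.divergence j j), ← div_lt_iff₀ (hD j)] at this
  have h2 := Finset.sum_lt_sum_of_nonempty Finset.univ_nonempty (fun j _ => h1 j)
  rw [← Finset.mul_sum, ← hT, inv_mul_cancel_right₀ hTpos.ne'] at h2
  exact h2.ne hcount.symm

lemma safeProb_toReal (S : ObservationModel M Y) {N : ℕ}
    (f : InferenceStrategy M Y N) (g : SelectionStrategy M Y N) (x : Fin (M + 1)) :
    (S.safeProb f g x).toReal =
      ∫ a, (f.rule a).real {Verdict.safe} ∂(S.historyLaw g x N le_rfl) := by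
  have := f.markov
  exact (integral_toReal (f.rule.measurable_coe trivial).aemeasurable
    (ae_of_all _ fun a => measure_lt_top _ _)).symm

lemma safeProb_succ_toReal (S : ObservationModel M Y) {B : ℝ} (hB0 : 0 ≤ B)
    (hB : ∀ (j u : Fin M) (k : Fin 2),
      ∀ᵐ y ∂(S.obsLaw k u), (S.logLikelihoodRatio j u y).abs < ENNReal.ofReal B)
    {N : ℕ} (f : InferenceStrategy M Y N) (g : SelectionStrategy M Y N) (j : Fin M) :
    (S.safeProb f g j.succ).toReal =
      ∫ a, (f.rule a).real {Verdict.safe} * Real.exp (-pathSum (S.truncLLR B j) a)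
        ∂(S.historyLaw g 0 N le_rfl) := by
  have := f.markov
  have hf : Measurable fun a => f.rule a {Verdict.safe} := f.rule.measurable_coe trivial
  have hL := measurable_pathSum (S.measurable_truncLLR B j) N
  rw [safeProb, S.lintegral_historyLaw_change g j.succ (S.measurable_truncLLR B j)
    (S.obsKernel_succ_eq_withDensity hB0 hB j) N le_rfl hf,
    ← integral_toReal (by fun_prop)
      (ae_of_all _ fun a => ENNReal.mul_lt_top (measure_lt_top _ _) ENNReal.ofReal_lt_top)]
  refine integral_congr_ae (ae_of_all _ fun a => ?_)
  simp [Measure.real, ENNReal.toReal_ofReal (Real.exp_nonneg _)]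

lemma maxMinDivergence_pos (hM : 0 < M) (S : ObservationModel M Y)
    (hD : ∀ u, 0 < S.divergence u u) : 0 < S.maxMinDivergence := by
  have : Nonempty (Fin M) := ⟨⟨0, hM⟩⟩
  rw [S.maxMinDivergence_eq hM hD]
  exact inv_pos.2 (Finset.sum_pos (fun u _ => inv_pos.2 (hD u)) Finset.univ_nonempty)

/-- Converse: under every admissible pair of strategies some anomaly goes undetected with
probability at least `(1 - ε) * exp (-N * (D + B * ε) / (1 - ε))`. -/
lemma exists_le_safeProb_succ (hM : 0 < M) (S : ObservationModel M Y)
    (hD : ∀ u, 0 < S.divergence u u) {B : ℝ} (hB0 : 0 ≤ B)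
    (hB : ∀ (j u : Fin M) (k : Fin 2),
      ∀ᵐ y ∂(S.obsLaw k u), (S.logLikelihoodRatio j u y).abs < ENNReal.ofReal B)
    {N : ℕ} (f : InferenceStrategy M Y N) (g : SelectionStrategy M Y N) {ε : ℝ}
    (hε0 : 0 < ε) (hε1 : ε < 1) (h : 1 - ε ≤ (S.safeProb f g 0).toReal) :
    ∃ j : Fin M, (1 - ε) * Real.exp (-(N * ((S.maxMinDivergence + B * ε) / (1 - ε)))) ≤
      (S.safeProb f g j.succ).toReal := by
  obtain ⟨j, hj⟩ := S.exists_integral_truncLLR_le hM hD hB0 hB g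
  refine ⟨j, ?_⟩
  have := f.markov
  have hpos := S.maxMinDivergence_pos hM hD
  have h1 : 0 < 1 - ε := by linarith
  have hf : Measurable fun a => (f.rule a).real {Verdict.safe} :=
    (f.rule.measurable_coe trivial).ennreal_toReal
  rw [S.safeProb_succ_toReal hB0 hB]
  rw [safeProb_toReal] at h
  -- Here `A = N * D*` and `K = N * B`; the exponent `m` is the one that turns the last hypothesis
  -- into an equality.
  refine mul_exp_neg_le_integral_mul_exp_neg _ hf (measurable_pathSum (S.measurable_truncLLR B j) N)
    (fun a => measureReal_nonneg) (fun a => measureReal_le_one)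
    (abs_pathSum_le (S.abs_truncLLR_le hB0 j)) h hj (by positivity) (by positivity) (le_of_eq ?_)
  field_simp

/-! ### Achievability -/

/-- The open-loop strategy that draws every component independently from `q`. -/
noncomputable def iidStrategy (Y : Type*) [MeasurableSpace Y] (q : PMF (Fin M)) (N : ℕ) :
    SelectionStrategy M Y N where
  rule _ := Kernel.const _ q.toMeasure
  markov _ := inferInstance

open Classical in
/-- The inference strategy that declares the system safe exactly on the event `E`. -/
noncomputable def indicatorInference {N : ℕ} (E : Set (History M Y N)) (hE : MeasurableSet E) :
    InferenceStrategy M Y N where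
  rule := Kernel.deterministic (fun a => if a ∈ E then Verdict.safe else Verdict.anomaly)
    (Measurable.ite hE measurable_const measurable_const)
  markov := inferInstance

lemma indicatorInference_rule {N : ℕ} (E : Set (History M Y N)) (hE : MeasurableSet E)
    (a : History M Y N) :
    (indicatorInference E hE).rule a {Verdict.safe} = E.indicator 1 a := by
  classical
  have hs : MeasurableSet {Verdict.safe} := trivial
  rw [indicatorInference, Kernel.deterministic_apply' _ _ hs]
  by_cases ha : a ∈ E <;> simp [ha]

lemma safeProb_indicatorInference (S : ObservationModel M Y) {N : ℕ} (E : Set (History M Y N))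
    (hE : MeasurableSet E) (g : SelectionStrategy M Y N) (x : Fin (M + 1)) :
    S.safeProb (indicatorInference E hE) g x = S.historyLaw g x N le_rfl E := by
  simp only [safeProb, indicatorInference_rule]
  exact lintegral_indicator_one hE

/-- Exponentially decaying probability that a log-likelihood ratio falls below its mean rate. -/
lemma exists_measure_pathSum_lt_le (S : ObservationModel M Y) {B : ℝ} (hB0 : 0 ≤ B)
    (hB : ∀ (j u : Fin M) (k : Fin 2),
      ∀ᵐ y ∂(S.obsLaw k u), (S.logLikelihoodRatio j u y).abs < ENNReal.ofReal B)
    (q : PMF (Fin M)) (j : Fin M) {b : ℝ} (hb : b < (q j).toReal * S.divergence j j) :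
    ∃ r : ℝ, 0 < r ∧ r < 1 ∧ ∀ N : ℕ,
      S.historyLaw (iidStrategy Y q N) 0 N le_rfl {a | pathSum (S.truncLLR B j) a < N * b} ≤
        ENNReal.ofReal (r ^ N) := by
  have hm : Measurable fun p => b - S.truncLLR B j p :=
    measurable_const.sub (S.measurable_truncLLR B j)
  have hbd : ∀ p, |b - S.truncLLR B j p| ≤ |b| + B := fun p =>
    (abs_sub _ _).trans (add_le_add le_rfl (S.abs_truncLLR_le hB0 j p))
  have hmean : ∫ p, (b - S.truncLLR B j p) ∂(q.toMeasure ⊗ₘ S.obsKernel 0) < 0 := by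
    have hi : ∀ u, Integrable (fun y => S.truncLLR B j (u, y)) (S.obsLaw 0 u) := fun u =>
      Integrable.of_bound
        ((S.measurable_truncLLR B j).comp measurable_prodMk_left).aestronglyMeasurable B
        (ae_of_all _ fun y => S.abs_truncLLR_le hB0 j _)
    have h1 : ∀ u, ∫ y, (b - S.truncLLR B j (u, y)) ∂(S.obsKernel 0 u) = b - S.divergence j u :=
      fun u => by
        rw [obsKernel_zero, integral_sub (integrable_const _) (hi u),
          ← S.divergence_eq_integral_truncLLR (hB j u 0)]
        simp
    rw [Measure.integral_compProd
      (Integrable.of_bound hm.aestronglyMeasurable _ (ae_of_all _ hbd))]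
    simp only [h1]
    rw [integral_sub (integrable_const _) Integrable.of_finite,
      integral_fintype (f := fun u => S.divergence j u) .of_finite]
    have h2 : ∀ u, q.toMeasure.real {u} = (q u).toReal := fun u => by
      rw [Measure.real, PMF.toMeasure_apply_singleton _ _ (measurableSet_singleton u)]
    simp only [h2, smul_eq_mul, S.divergence_sum (fun u => (q u).toReal), integral_const,
      probReal_univ, one_mul]
    linarith
  obtain ⟨t, r, ht, hr0, hr1, hle⟩ := exists_lintegral_exp_mul_lt_one _ hm hbd hmean
  refine ⟨r, hr0, hr1, fun N => ?_⟩
  have hm' : Measurable fun p => t * (b - S.truncLLR B j p) := hm.const_mul t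
  have hexp : Measurable fun p => ENNReal.ofReal (Real.exp (t * (b - S.truncLLR B j p))) := by
    fun_prop
  rw [Measure.lintegral_compProd hexp] at hle
  -- The selection ignores the past, so the single-experiment bound `hle` serves for every history.
  have hmgf := S.lintegral_exp_pathSum_le (iidStrategy Y q N) 0 hm' (fun _ _ => hle) N le_rfl
  have hsum : ∀ a : History M Y N, pathSum (fun p => t * (b - S.truncLLR B j p)) a =
      t * (N * b - pathSum (S.truncLLR B j) a) := fun a => by
    simp [pathSum, ← Finset.mul_sum]
  -- Markov's inequality at level `1`: on the event the exponent `t * (N * b - pathSum …)` is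
  -- nonnegative.
  have hmk := mul_meas_ge_le_lintegral (μ := S.historyLaw (iidStrategy Y q N) 0 N le_rfl)
    (measurable_pathSum hm' N).exp.ennreal_ofReal 1
  rw [one_mul] at hmk
  rw [ENNReal.ofReal_pow hr0.le]
  refine (measure_mono fun a ha => ?_).trans (hmk.trans hmgf)
  change 1 ≤ ENNReal.ofReal _
  rw [hsum, ENNReal.one_le_ofReal, Real.one_le_exp_iff]
  have : pathSum (S.truncLLR B j) a < N * b := ha
  exact mul_nonneg ht.le (by linarith)

/-- Achievability: a likelihood-ratio test with open-loop selection from the max-min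
distribution attains every rate below the max-min divergence. -/
lemma eventually_exists_strategy (hM : 0 < M) (S : ObservationModel M Y)
    (hD : ∀ u, 0 < S.divergence u u) {B : ℝ} (hB0 : 0 ≤ B)
    (hB : ∀ (j u : Fin M) (k : Fin 2),
      ∀ᵐ y ∂(S.obsLaw k u), (S.logLikelihoodRatio j u y).abs < ENNReal.ofReal B)
    {ε : ℕ → ℝ} (hε : ∀ N, 0 < ε N)
    (hε_log : Tendsto (fun N : ℕ => -Real.log (ε N) / (N : ℝ)) atTop (𝓝 0))
    {b : ℝ} (hb : b < S.maxMinDivergence) :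
    ∀ᶠ N in atTop, ∃ (f : InferenceStrategy M Y N) (g : SelectionStrategy M Y N),
      1 - ε N ≤ (S.safeProb f g 0).toReal ∧
        ∀ j : Fin M, (S.safeProb f g j.succ).toReal ≤ Real.exp (-(N * b)) := by
  have : Nonempty (Fin M) := ⟨⟨0, hM⟩⟩
  have hpos := S.maxMinDivergence_pos hM hD
  have hq : ∑ u, ENNReal.ofReal (S.maxMinDivergence * (S.divergence u u)⁻¹) = 1 := by
    rw [← ENNReal.ofReal_sum_of_nonneg
      (fun u _ => mul_nonneg hpos.le (inv_pos.2 (hD u)).le), ← Finset.mul_sum]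
    have h1 := S.maxMinDivergence_eq hM hD
    rw [← inv_inv (∑ u, (S.divergence u u)⁻¹), ← h1, mul_inv_cancel₀ hpos.ne', ENNReal.ofReal_one]
  let q : PMF (Fin M) := PMF.ofFintype _ hq
  have hqj : ∀ j, (q j).toReal * S.divergence j j = S.maxMinDivergence := fun j => by
    rw [PMF.ofFintype_apply, ENNReal.toReal_ofReal (mul_nonneg hpos.le (inv_pos.2 (hD j)).le),
      inv_mul_cancel_right₀ (hD j).ne']
  choose r hr0 hr1 hr using fun j =>
    S.exists_measure_pathSum_lt_le hB0 hB q j (hb.trans_eq (hqj j).symm)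
  have hMR : (0 : ℝ) < M := by exact_mod_cast hM
  -- The factor `M` prepares a union bound over the anomalies. In logarithms per experiment, `-log
  -- (ε N / M)` tends to `0` while `-log (r j)` stays positive.
  have hev : ∀ j, ∀ᶠ N : ℕ in atTop, r j ^ N ≤ ε N / M := fun j => by
    have hlim : Tendsto (fun N : ℕ => -Real.log (ε N) / (N : ℝ) + Real.log M / (N : ℝ)) atTop
        (𝓝 (0 + 0)) := hε_log.add (tendsto_const_div_atTop_nhds_zero_nat _)
    have hlt : 0 + 0 < -Real.log (r j) := by
      linarith [Real.log_neg (hr0 j) (hr1 j)]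
    filter_upwards [hlim.eventually_lt_const hlt, eventually_gt_atTop 0] with N hN hN0
    have hNR : (0 : ℝ) < N := by exact_mod_cast hN0
    rw [← add_div, div_lt_iff₀ hNR] at hN
    rw [← Real.log_le_log_iff (pow_pos (hr0 j) N) (div_pos (hε N) hMR), Real.log_pow,
      Real.log_div (hε N).ne' hMR.ne']
    linarith
  filter_upwards [eventually_all.2 hev] with N hN
  have hmeas : ∀ j, Measurable (pathSum (S.truncLLR B j) : History M Y N → ℝ) := fun j =>
    measurable_pathSum (S.measurable_truncLLR B j) N
  have hE : MeasurableSet {a : History M Y N | ∀ j, N * b ≤ pathSum (S.truncLLR B j) a} := by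
    rw [Set.ofPred_forall]
    exact MeasurableSet.iInter fun j => measurableSet_le measurable_const (hmeas j)
  set E := {a : History M Y N | ∀ j, N * b ≤ pathSum (S.truncLLR B j) a} with hEdef
  refine ⟨indicatorInference E hE, iidStrategy Y q N, ?_, fun j => ?_⟩
  · rw [safeProb_indicatorInference]
    have hc : S.historyLaw (iidStrategy Y q N) 0 N le_rfl Eᶜ ≤ ENNReal.ofReal (ε N) := by
      have hsub : Eᶜ ⊆ ⋃ j, {a | pathSum (S.truncLLR B j) a < N * b} := fun a ha => by
        simpa [hEdef] using ha
      refine (measure_mono hsub).trans ((measure_iUnion_fintype_le _ _).trans ?_)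
      refine (Finset.sum_le_sum fun j _ =>
        (hr j N).trans (ENNReal.ofReal_le_ofReal (hN j))).trans (le_of_eq ?_)
      rw [← ENNReal.ofReal_sum_of_nonneg fun j _ => (div_pos (hε N) hMR).le]
      congr 1
      simp [mul_div_cancel₀ _ hMR.ne']
    have h1 : (S.historyLaw (iidStrategy Y q N) 0 N le_rfl).real Eᶜ ≤ ε N :=
      ENNReal.toReal_le_of_le_ofReal (hε N).le hc
    rw [probReal_compl_eq_one_sub hE] at h1
    change 1 - ε N ≤ (S.historyLaw (iidStrategy Y q N) 0 N le_rfl).real E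
    linarith
  -- After the change of measure to hypothesis `0`, the density `exp (-pathSum …)` is at most `exp
  -- (-(N * b))` on the acceptance event.
  · refine ENNReal.toReal_le_of_le_ofReal (Real.exp_nonneg _) ?_
    rw [safeProb, S.lintegral_historyLaw_change _ j.succ (S.measurable_truncLLR B j)
      (S.obsKernel_succ_eq_withDensity hB0 hB j) N le_rfl
      ((indicatorInference E hE).rule.measurable_coe trivial)]
    calc _ ≤ ∫⁻ _, ENNReal.ofReal (Real.exp (-(N * b)))
          ∂(S.historyLaw (iidStrategy Y q N) 0 N le_rfl) := by
          refine lintegral_mono fun a => ?_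
          rw [indicatorInference_rule]
          by_cases ha : a ∈ E
          · rw [Set.indicator_of_mem ha, Pi.one_apply, one_mul]
            exact ENNReal.ofReal_le_ofReal (Real.exp_le_exp.2 (neg_le_neg (ha j)))
          · simp [ha]
      _ = _ := by simp

end ObservationModel

end AnomalyVerification

/-! ### The limit -/

open AnomalyVerification in
theorem mainTheorem3 {M : ℕ} (hM : 0 < M) {Y : Type*} [MeasurableSpace Y]
    (S : AnomalyVerification.ObservationModel M Y)
    (ρ : PMF (Fin (M + 1))) (hρ : ∀ x, 0 < ρ x)
    (hD : ∀ u, 0 < S.divergence u u)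
    (hB : ∃ B : ℝ, 0 < B ∧ ∀ (j u : Fin M) (k : Fin 2),
      ∀ᵐ y ∂(S.obsLaw k u), (S.logLikelihoodRatio j u y).abs < ENNReal.ofReal B)
    (ε : ℕ → ℝ) (hε : ∀ N, 0 < ε N ∧ ε N < 1)
    (hε_zero : Tendsto ε atTop (𝓝 0))
    (hε_log : Tendsto (fun N : ℕ => -Real.log (ε N) / (N : ℝ)) atTop (𝓝 0)) :
    (∀ N, 0 < S.optimalIncorrectProb ρ N (ε N)) ∧
      Tendsto (fun N : ℕ => -(1 / (N : ℝ)) * Real.log (S.optimalIncorrectProb ρ N (ε N)))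
        atTop (𝓝 S.maxMinDivergence) := by
  obtain ⟨B, hB0, hB⟩ := hB
  have : Nonempty (Fin M) := ⟨⟨0, hM⟩⟩
  have hρr : ∀ j : Fin M, 0 < (ρ j.succ).toReal := fun j =>
    ENNReal.toReal_pos (hρ _).ne' (ρ.apply_ne_top _)
  set T := ∑ j : Fin M, (ρ j.succ).toReal with hT
  have hTpos : 0 < T := Finset.sum_pos (fun j _ => hρr j) Finset.univ_nonempty
  -- The anomaly `j` of the converse depends on the strategies; bounding its prior weight below by
  -- the smallest one makes the constant `w` uniform.
  obtain ⟨i, hi⟩ := Finite.exists_min fun j : Fin M => (ρ j.succ).toReal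
  set w := (ρ i.succ).toReal / T with hw
  have hwpos : 0 < w := div_pos (hρr i) hTpos
  have h1ε : ∀ N, 0 < 1 - ε N := fun N => by linarith [(hε N).2]
  set m : ℕ → ℝ := fun N => (S.maxMinDivergence + B * ε N) / (1 - ε N) with hm
  have hlow : ∀ N, ∀ φ ∈ {φ : ℝ | ∃ (f : InferenceStrategy M Y N) (g : SelectionStrategy M Y N),
      1 - ε N ≤ S.correctProb ρ f g ∧ φ = S.incorrectProb ρ f g},
      w * ((1 - ε N) * Real.exp (-(N * m N))) ≤ φ := by
    rintro N φ ⟨f, g, hfg, rfl⟩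
    rw [S.correctProb_eq hρ] at hfg
    obtain ⟨j, hj⟩ := S.exists_le_safeProb_succ hM hD hB0.le hB f g (hε N).1 (hε N).2 hfg
    rw [S.incorrectProb_eq, hw, div_mul_eq_mul_div, ← hT]
    refine div_le_div_of_nonneg_right ?_ hTpos.le
    calc _ ≤ (S.safeProb f g j.succ).toReal * (ρ j.succ).toReal := by
          rw [mul_comm]
          exact mul_le_mul hj (hi j) (hρr i).le ENNReal.toReal_nonneg
      _ ≤ _ := Finset.single_le_sum
          (f := fun j : Fin M => (S.safeProb f g j.succ).toReal * (ρ j.succ).toReal)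
          (fun k _ => mul_nonneg ENNReal.toReal_nonneg (hρr k).le) (Finset.mem_univ j)
  -- Always declaring safe is admissible. Without an admissible pair the real `sInf` would be `0` by
  -- convention.
  have hne : ∀ N, {φ : ℝ | ∃ (f : InferenceStrategy M Y N) (g : SelectionStrategy M Y N),
      1 - ε N ≤ S.correctProb ρ f g ∧ φ = S.incorrectProb ρ f g}.Nonempty := fun N => by
    refine ⟨_, ObservationModel.indicatorInference Set.univ MeasurableSet.univ,
      ObservationModel.iidStrategy Y (PMF.pure i) N, ?_, rfl⟩
    rw [S.correctProb_eq hρ, S.safeProb_indicatorInference]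
    simp [(hε N).1.le]
  have hlow' : ∀ N, w * ((1 - ε N) * Real.exp (-(N * m N))) ≤
      S.optimalIncorrectProb ρ N (ε N) := fun N => le_csInf (hne N) (hlow N)
  have hlpos : ∀ N, 0 < w * ((1 - ε N) * Real.exp (-(N * m N))) := fun N =>
    mul_pos hwpos (mul_pos (h1ε N) (Real.exp_pos _))
  have hpos : ∀ N, 0 < S.optimalIncorrectProb ρ N (ε N) := fun N => (hlpos N).trans_le (hlow' N)
  refine ⟨hpos, tendsto_order.2 ⟨fun a ha => ?_, fun a ha => ?_⟩⟩
  · obtain ⟨b, hab, hb⟩ := exists_between ha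
    filter_upwards [S.eventually_exists_strategy hM hD hB0.le hB (fun N => (hε N).1) hε_log hb,
      eventually_gt_atTop 0] with N hN hN0
    have hNR : (0 : ℝ) < N := by exact_mod_cast hN0
    obtain ⟨f, g, hfg, hfg'⟩ := hN
    have hle : S.optimalIncorrectProb ρ N (ε N) ≤ Real.exp (-(N * b)) := by
      refine (csInf_le ⟨_, hlow N⟩ ⟨f, g, by rwa [S.correctProb_eq hρ], rfl⟩).trans ?_
      rw [S.incorrectProb_eq, ← hT, div_le_iff₀ hTpos, hT, Finset.mul_sum]
      exact Finset.sum_le_sum fun j _ => mul_le_mul_of_nonneg_right (hfg' j) (hρr j).le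
    have hlog := (Real.log_le_iff_le_exp (hpos N)).2 hle
    refine hab.trans_le ?_
    rw [neg_mul, one_div_mul_eq_div, ← neg_div, le_div_iff₀ hNR]
    linarith
  -- Taking logarithms in `hlow'` bounds the rate by this sequence. The prior constant and `log (1 -
  -- ε N)` vanish after division by `N`, and `m N` tends to `D*` because `ε N` tends to `0`.
  · have hlim : Tendsto (fun N : ℕ => -(Real.log w + Real.log (1 - ε N)) * (1 / (N : ℝ)) + m N)
        atTop (𝓝 (-(Real.log w + Real.log (1 - 0)) * 0 +
          (S.maxMinDivergence + B * 0) / (1 - 0))) := by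
      have h1 : Tendsto (fun N => 1 - ε N) atTop (𝓝 (1 - 0)) := hε_zero.const_sub 1
      refine Tendsto.add (Tendsto.mul ((h1.log (by norm_num)).const_add _).neg
        tendsto_one_div_atTop_nhds_zero_nat) ?_
      exact ((hε_zero.const_mul B).const_add _).div h1 (by norm_num)
    rw [mul_zero, mul_zero, add_zero, zero_add, sub_zero, div_one] at hlim
    filter_upwards [hlim.eventually_lt_const ha, eventually_gt_atTop 0] with N hN hN0
    have hNR : (0 : ℝ) < N := by exact_mod_cast hN0
    refine lt_of_le_of_lt ?_ hN
    have hlog := Real.log_le_log (hlpos N) (hlow' N)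
    rw [Real.log_mul hwpos.ne' (mul_pos (h1ε N) (Real.exp_pos _)).ne',
      Real.log_mul (h1ε N).ne' (Real.exp_pos _).ne', Real.log_exp] at hlog
    have hmN : m N = (N * m N) * (1 / (N : ℝ)) := by field_simp
    rw [hmN, ← add_mul, neg_mul, mul_comm (1 / (N : ℝ)), ← neg_mul]
    exact mul_le_mul_of_nonneg_right (by linarith) (by positivity)
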